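/- Let $\mathbb D=\{z\in\mathbb C:|z|<1\}$. Let $f:\mathbb D\to\mathbb C$ be a holomorphic infinitesimal generator, i.e. for every $z\in\mathbb D$ the Cauchy problem $\frac{\partial u(t,z)}{\partial t}+f(u(t,z))=0$, $u(0,z)=z$, has a unique solution $u(t,z)\in\mathbb D$ for all $t\ge 0$. Suppose that $f(0)=0$ and that $q:=f'(0)$ satisfies $\Re q>0$. For $r>0$ let $G_r:=(\mathrm{Id}+rf)^{-1}:\mathbb D\to\mathbb D$ be the nonlinear resolvent of $f$, so that $w=G_r(z)$ is the point of $\mathbb D$ with $w+rf(w)=z$. Then: 1. for every $r>\frac{2}{\Re q}$ one has $|G_r(z)|\le\dfrac{3}{1+r\,\Re q}$ for all $z\in\mathbb D$; 2. for every $r>\frac{2}{\Re q}$ the map $G_r$ has no boundary fixed points, that is, there is no $\zeta$ with $|\zeta|=1$ at which the angular (non-tangential) limit of $G_r$ exists and equals $\zeta$; 3. $G_r\to 0$ uniformly on $\mathbb D$ as $r\to\infty$. -/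

import Mathlib

open Filter Topology

/-- `u` solves the Cauchy problem `u' + f(u) = 0`, `u(0) = z` on `[0, ∞)`, with values in the
open unit disk. -/
def IsDiskFlowLine (f : ℂ → ℂ) (z : ℂ) (u : ℝ → ℂ) : Prop :=
  u 0 = z ∧ ∀ t : ℝ, 0 ≤ t →
    u t ∈ Metric.ball (0 : ℂ) 1 ∧ HasDerivWithinAt u (-f (u t)) (Set.Ici 0) t

/-- An infinitesimal generator on the open unit disk: a holomorphic function on the disk for which
the Cauchy problem `u' + f(u) = 0`, `u(0) = z` has, for every `z` in the disk, a unique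
solution in the disk for all times `t ≥ 0`. -/
def IsDiskGenerator (f : ℂ → ℂ) : Prop :=
  DifferentiableOn ℂ f (Metric.ball (0 : ℂ) 1) ∧
    ∀ z ∈ Metric.ball (0 : ℂ) 1, ∃ u : ℝ → ℂ, IsDiskFlowLine f z u ∧
      ∀ v : ℝ → ℂ, IsDiskFlowLine f z v → Set.EqOn v u (Set.Ici 0)

/-- The nonlinear resolvent `G_r = (Id + r f)⁻¹`, the inverse being that of the map `Id + r f` on
the open unit disk: `nonlinearResolvent f r z` is the point `w` of the disk
with `w + r f(w) = z`. -/
noncomputable def nonlinearResolvent (f : ℂ → ℂ) (r : ℝ) : ℂ → ℂ :=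
  Function.invFunOn (fun w : ℂ => w + (r : ℂ) * f w) (Metric.ball (0 : ℂ) 1)

/-- The Stolz region in the open unit disk with vertex `ζ` and aperture `M`. -/
def stolzRegion (ζ : ℂ) (M : ℝ) : Set ℂ :=
  {z : ℂ | ‖z‖ < 1 ∧ ‖ζ - z‖ < M * (1 - ‖z‖)}

/-- `ζ` on the unit circle is a boundary fixed point of `G` if the angular (non-tangential) limit
of `G` at `ζ` exists and equals `ζ`. -/
def IsBoundaryFixedPoint (G : ℂ → ℂ) (ζ : ℂ) : Prop :=
  ‖ζ‖ = 1 ∧ ∀ M : ℝ, 1 < M → Tendsto G (𝓝[stolzRegion ζ M] ζ) (𝓝 ζ)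

open Metric Set

/-! Uniqueness makes 0 a fixed point of the flow, and time-`T` maps are holomorphic, so the Schwarz
lemma gives `‖F z t‖ ≤ ‖z‖`. Differentiating at `t = 0` shows that `p(z) = f(z)/z` (`dslope f 0`)
has `Re p ≥ 0`, and `re_harnack` bounds `Re p` below. The resolvent equation reads `w (1 + r p(w)) =
z`. With `a = r Re q > 2`, Harnack yields `‖w‖ < 1/(a - 1) < 3/(1 + a) < 1`, from which all three
claims follow. -/

/-! ### Holomorphic dependence of the flow on the initial point -/

/-- First and second order Taylor estimates for a holomorphic function on a smaller closed disk. -/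
theorem exists_taylor_bounds {f : ℂ → ℂ} (hf : DifferentiableOn ℂ f (ball 0 1))
    {ρ : ℝ} (hρ : ρ < 1) :
    ∃ L M : ℝ, 0 ≤ L ∧ 0 ≤ M ∧ ∀ a ∈ closedBall (0 : ℂ) ρ, ∀ b ∈ closedBall (0 : ℂ) ρ,
      ‖f b - f a‖ ≤ L * ‖b - a‖ ∧ ‖f b - f a - deriv f a * (b - a)‖ ≤ M * ‖b - a‖ ^ 2 := by
  have hsub : closedBall (0 : ℂ) ρ ⊆ ball 0 1 := closedBall_subset_ball hρ
  have hf1 := hf.deriv isOpen_ball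
  have hf2 := hf1.deriv isOpen_ball
  obtain ⟨L, hL⟩ := (isCompact_closedBall (0 : ℂ) ρ).exists_bound_of_continuousOn
    (hf1.continuousOn.mono hsub)
  obtain ⟨M, hM⟩ := (isCompact_closedBall (0 : ℂ) ρ).exists_bound_of_continuousOn
    (hf2.continuousOn.mono hsub)
  have hd {g : ℂ → ℂ} (hg : DifferentiableOn ℂ g (ball 0 1)) {x : ℂ}
      (hx : x ∈ closedBall (0 : ℂ) ρ) : HasDerivAt g (deriv g x) x :=
    (hg.differentiableAt (isOpen_ball.mem_nhds (hsub hx))).hasDerivAt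
  refine ⟨max L 0, max M 0, le_max_right _ _, le_max_right _ _, fun a ha b hb => ⟨?_, ?_⟩⟩
  · exact (convex_closedBall (0 : ℂ) ρ).norm_image_sub_le_of_norm_hasDerivWithin_le
      (fun x hx => (hd hf hx).hasDerivWithinAt) (fun x hx => (hL x hx).trans (le_max_left _ _)) ha hb
  -- On this smaller convex set `deriv f` differs from `deriv f a` by at most `M * ‖b - a‖`.
  · have hconv : Convex ℝ (closedBall (0 : ℂ) ρ ∩ closedBall a ‖b - a‖) :=
      (convex_closedBall _ _).inter (convex_closedBall _ _)
    have key := hconv.norm_image_sub_le_of_norm_hasDerivWithin_le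
      (f := fun x => f x - deriv f a * x) (f' := fun x => deriv f x - deriv f a)
      (C := max M 0 * ‖b - a‖) (x := a) (y := b)
      (fun x hx => ((hd hf hx.1).sub (by
        simpa using (hasDerivAt_id x).const_mul (deriv f a))).hasDerivWithinAt)
      (fun x hx => by
        refine ((convex_closedBall (0 : ℂ) ρ).norm_image_sub_le_of_norm_hasDerivWithin_le
          (fun y hy => (hd hf1 hy).hasDerivWithinAt)
          (fun y hy => (hM y hy).trans (le_max_left _ 0)) ha hx.1).trans ?_
        gcongr
        simpa [dist_eq_norm] using hx.2)
      ⟨ha, by simp⟩ ⟨hb, by simp [dist_eq_norm]⟩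
    calc _ = ‖f b - deriv f a * b - (f a - deriv f a * a)‖ := by congr 1; ring
      _ ≤ _ := key
      _ = _ := by ring

theorem IsDiskFlowLine.continuousOn {f : ℂ → ℂ} {z : ℂ} {u : ℝ → ℂ} (hu : IsDiskFlowLine f z u) :
    ContinuousOn u (Ici 0) :=
  fun t ht => (hu.2 t ht).2.continuousWithinAt

theorem IsDiskFlowLine.exists_norm_le {f : ℂ → ℂ} {z : ℂ} {u : ℝ → ℂ} (hu : IsDiskFlowLine f z u)
    (T : ℝ) : ∃ ρ < 1, ∀ t ∈ Icc 0 T, ‖u t‖ ≤ ρ := by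
  rcases (Icc 0 T).eq_empty_or_nonempty with h | h
  · exact ⟨0, by norm_num, by simp [h]⟩
  · obtain ⟨s, hs, hmax⟩ := isCompact_Icc.exists_isMaxOn h
      (hu.continuousOn.mono Icc_subset_Ici_self).norm
    exact ⟨‖u s‖, by simpa using (hu.2 s hs.1).1, fun t ht => hmax ht⟩

/-- Flow lines starting near `z` stay exponentially close to the flow line of `z` up to a given
time. -/
theorem IsDiskFlowLine.norm_sub_le {f : ℂ → ℂ} {z w : ℂ} {u v : ℝ → ℂ}
    (hu : IsDiskFlowLine f z u) (hv : IsDiskFlowLine f w v) {T ρ ρ' L : ℝ} (hρ : ρ ≤ ρ')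
    (hL0 : 0 ≤ L) (hL : ∀ a ∈ closedBall (0 : ℂ) ρ', ∀ b ∈ closedBall (0 : ℂ) ρ',
      ‖f b - f a‖ ≤ L * ‖b - a‖)
    (huρ : ∀ t ∈ Icc 0 T, ‖u t‖ ≤ ρ) (hwz : w ≠ z)
    (hw : ‖w - z‖ * Real.exp ((L + 1) * T) ≤ ρ' - ρ) :
    ∀ t ∈ Icc 0 T, ‖v t - u t‖ ≤ ‖w - z‖ * Real.exp ((L + 1) * t) := by
  have hpos : 0 < ‖w - z‖ := norm_pos_iff.2 (sub_ne_zero.2 hwz)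
  -- The comparison needs a strict inequality, only where the bound is attained; the rate `L + 1`
  -- and `w ≠ z` supply it.
  refine image_norm_le_of_norm_deriv_right_lt_deriv_boundary
    (f := fun t => v t - u t) (f' := fun t => -f (v t) - -f (u t))
    (B' := fun t => ‖w - z‖ * (Real.exp ((L + 1) * t) * (L + 1)))
    ((hv.continuousOn.sub hu.continuousOn).mono Icc_subset_Ici_self)
    (fun x hx => ((hv.2 x hx.1).2.sub (hu.2 x hx.1).2).mono (Ici_subset_Ici.2 hx.1))
    (by simp [hu.1, hv.1]) (fun x => ?_) (fun x hx heq => ?_)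
  · simpa using (((hasDerivAt_id x).const_mul (L + 1)).exp).const_mul ‖w - z‖
  · have hx' : x ∈ Icc 0 T := Ico_subset_Icc_self hx
    have hle : ‖v x - u x‖ ≤ ρ' - ρ := by
      rw [heq]
      refine le_trans ?_ hw
      gcongr
      exact hx.2.le
    have h1 : u x ∈ closedBall (0 : ℂ) ρ' := by simpa using (huρ x hx').trans hρ
    have h2 : v x ∈ closedBall (0 : ℂ) ρ' := by
      have := norm_add_le (v x - u x) (u x)
      rw [sub_add_cancel] at this
      simpa using this.trans (by linarith [huρ x hx'])
    have h3 := hL _ h1 _ h2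
    calc ‖-f (v x) - -f (u x)‖ = ‖f (v x) - f (u x)‖ := by
          rw [← norm_neg]; congr 1; ring
      _ ≤ L * ‖v x - u x‖ := h3
      _ = L * (‖w - z‖ * Real.exp ((L + 1) * x)) := by rw [heq]
      _ < (L + 1) * (‖w - z‖ * Real.exp ((L + 1) * x)) := by
          gcongr
          linarith
      _ = _ := by ring

/-- The time `T` map of the flow is holomorphic in the initial point. -/
theorem differentiableAt_flow {f : ℂ → ℂ} (hf : DifferentiableOn ℂ f (ball 0 1))
    {F : ℂ → ℝ → ℂ} (hF : ∀ z ∈ ball (0 : ℂ) 1, IsDiskFlowLine f z (F z)) {T : ℝ} (hT : 0 ≤ T)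
    {z : ℂ} (hz : z ∈ ball (0 : ℂ) 1) : DifferentiableAt ℂ (fun w => F w T) z := by
  have hu := hF z hz
  obtain ⟨ρ, hρ1, hρ⟩ := hu.exists_norm_le T
  obtain ⟨ρ', hρρ', hρ'1⟩ := exists_between hρ1
  obtain ⟨L, M, hL0, hM0, hLM⟩ := exists_taylor_bounds hf hρ'1
  -- the integrating factor of the variational equation
  set a : ℝ → ℂ := fun s => deriv f (F z (max 0 s)) with ha
  -- Truncation at 0 makes `a` continuous on all of ℝ.
  have hacont : Continuous a := by
    have h1 : ContinuousOn (fun s => deriv f (F z s)) (Ici 0) :=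
      (hf.deriv isOpen_ball).continuousOn.comp hu.continuousOn fun t ht => (hu.2 t ht).1
    exact h1.comp_continuous (f := fun s : ℝ => max 0 s) (by fun_prop) fun s => mem_Ici.2 (le_max_left _ _)
  set E : ℝ → ℂ := fun t => Complex.exp (∫ s in (0 : ℝ)..t, a s) with hE
  have hEd : ∀ t, HasDerivAt E (E t * a t) t := fun t =>
    (intervalIntegral.integral_hasDerivAt_right (hacont.intervalIntegrable _ _)
      hacont.aestronglyMeasurable.stronglyMeasurableAtFilter hacont.continuousAt).cexp
  have hE0 : E 0 = 1 := by simp [hE]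
  obtain ⟨K, hK⟩ := (isCompact_Icc (a := (0 : ℝ)) (b := T)).exists_bound_of_continuousOn
    (fun t _ => (hEd t).continuousAt.continuousWithinAt)
  have hK0 : 0 ≤ K := (norm_nonneg _).trans (hK 0 ⟨le_rfl, hT⟩)
  set c := Real.exp ((L + 1) * T) with hc
  have hc0 : 0 < c := Real.exp_pos _
  have hnear : ∀ᶠ w in 𝓝 z, w ∈ ball (0 : ℂ) 1 ∧ ‖w - z‖ * c ≤ ρ' - ρ := by
    refine (isOpen_ball.eventually_mem hz).and ?_
    have h : Tendsto (fun w : ℂ => ‖w - z‖ * c) (𝓝 z) (𝓝 (‖z - z‖ * c)) :=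
      Continuous.tendsto (by fun_prop) z
    rw [sub_self, norm_zero, zero_mul] at h
    exact h.eventually (eventually_le_nhds (by linarith))
  -- Since `E' = E * a`, the linear term cancels in the derivative of `E t * (F w t - F z t)`,
  -- leaving a quadratic Taylor remainder.
  have hquad : ∀ᶠ w in 𝓝 z, ‖E T * (F w T - F z T) - (w - z)‖ ≤
      K * (M * c ^ 2) * T * ‖(w - z) ^ 2‖ := by
    filter_upwards [hnear] with w hw
    rcases eq_or_ne w z with rfl | hwz
    · simp
    have hv := hF w hw.1
    have hd := hu.norm_sub_le hv hρρ'.le hL0 (fun a ha b hb => (hLM a ha b hb).1) hρ hwz hw.2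
    have hdc : ∀ t ∈ Icc 0 T, ‖F w t - F z t‖ ≤ ‖w - z‖ * c := fun t ht => by
      refine (hd t ht).trans ?_
      rw [hc]
      gcongr
      exact ht.2
    have key := (convex_Icc (0 : ℝ) T).norm_image_sub_le_of_norm_hasDerivWithin_le
      (f := fun t => E t * (F w t - F z t))
      (f' := fun t => E t * a t * (F w t - F z t) + E t * (-f (F w t) - -f (F z t)))
      (C := K * (M * (‖w - z‖ * c) ^ 2)) (x := 0) (y := T)
      (fun t ht => (hEd t).hasDerivWithinAt.mul
        (((hv.2 t ht.1).2.sub (hu.2 t ht.1).2).mono Icc_subset_Ici_self))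
      (fun t ht => ?_) ⟨le_rfl, hT⟩ ⟨hT, le_rfl⟩
    · rw [hE0, hv.1, hu.1, one_mul, sub_zero, Real.norm_of_nonneg hT] at key
      refine key.trans (le_of_eq ?_)
      rw [norm_pow]
      ring
    · have hat : a t = deriv f (F z t) := by simp only [ha, max_eq_right ht.1]
      have h1 : F z t ∈ closedBall (0 : ℂ) ρ' := by simpa using (hρ t ht).trans hρρ'.le
      have h2 : F w t ∈ closedBall (0 : ℂ) ρ' := by
        have := norm_add_le (F w t - F z t) (F z t)
        rw [sub_add_cancel] at this
        simpa using this.trans (by linarith [hρ t ht, hdc t ht, hw.2])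
      calc _ = ‖E t‖ * ‖f (F w t) - f (F z t) - deriv f (F z t) * (F w t - F z t)‖ := by
            rw [hat, ← norm_mul, ← norm_neg]; congr 1; ring
        _ ≤ K * (M * ‖F w t - F z t‖ ^ 2) := by
            gcongr
            exacts [hK t ht, (hLM _ h1 _ h2).2]
        _ ≤ _ := by
            gcongr
            exact hdc t ht
  have hderiv : HasDerivAt (fun w => E T * F w T) 1 z := by
    rw [hasDerivAt_iff_isLittleO]
    refine (Asymptotics.IsBigO.of_bound (K * (M * c ^ 2) * T) (g := fun w => ‖w - z‖ ^ 2)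
      ?_).trans_isLittleO (Asymptotics.isLittleO_pow_sub_sub z one_lt_two)
    filter_upwards [hquad] with w hw
    rw [← norm_pow, norm_norm]
    rwa [← mul_sub, smul_eq_mul, mul_one]
  have hET : E T ≠ 0 := Complex.exp_ne_zero _
  simpa [hET] using hderiv.differentiableAt.const_mul (E T)⁻¹

/-! ### Positivity and Harnack's inequality -/

/-- A generator vanishing at the origin points outwards. -/
theorem IsDiskGenerator.re_conj_mul_nonneg {f : ℂ → ℂ} (hf : IsDiskGenerator f) (hf0 : f 0 = 0)
    {z : ℂ} (hz : z ∈ ball (0 : ℂ) 1) : 0 ≤ (starRingEnd ℂ z * f z).re := by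
  choose! F hF huniq using hf.2
  have h0 : (0 : ℂ) ∈ ball (0 : ℂ) 1 := by simp
  have hF0 : ∀ t, 0 ≤ t → F 0 t = 0 := fun t ht =>
    (huniq 0 h0 (fun _ => 0) ⟨rfl, fun t _ =>
      ⟨h0, by simpa [hf0] using hasDerivWithinAt_const t (Ici 0) (0 : ℂ)⟩⟩ ht).symm
  have hle : ∀ t, 0 ≤ t → ‖F z t‖ ≤ ‖z‖ := fun t ht =>
    Complex.norm_le_norm_of_mapsTo_ball (f := fun w => F w t) (R := 1)
      (fun w hw => (differentiableAt_flow hf.1 hF ht hw).differentiableWithinAt)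
      (fun w hw => ball_subset_closedBall ((hF w hw).2 t ht).1) (hF0 t ht) (by simpa using hz)
  have hd := ((hF z hz).2 0 le_rfl).2
  have hd2 := hd.norm_sq
  rw [(hF z hz).1] at hd2
  have hmax : IsMaxOn (fun t => ‖F z t‖ ^ 2) (Ici 0) 0 := fun t ht => by
    simp only [mem_ofPred_eq, (hF z hz).1]
    exact pow_le_pow_left₀ (norm_nonneg _) (hle t ht) 2
  -- At the endpoint 0, a maximum only forces the right derivative to be nonpositive.
  have h := hmax.localize.hasFDerivWithinAt_nonpos hd2.hasFDerivWithinAt (y := 1)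
    (mem_posTangentConeAt_of_segment_subset (by
      rw [segment_eq_Icc (by norm_num)]; simpa using Icc_subset_Ici_self))
  simp only [Complex.inner] at h
  simp at h
  simp
  linarith

/-- **Harnack's inequality** for a holomorphic function with non-negative real part. -/
theorem re_harnack {p : ℂ → ℂ} (hp : DifferentiableOn ℂ p (ball 0 1))
    (hre : ∀ z ∈ ball (0 : ℂ) 1, 0 ≤ (p z).re) (h0 : 0 < (p 0).re) {z : ℂ}
    (hz : z ∈ ball (0 : ℂ) 1) : (p 0).re * (1 - ‖z‖) ≤ (p z).re * (1 + ‖z‖) := by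
  set q := p 0 with hq
  have hden : ∀ w ∈ ball (0 : ℂ) 1, p w + starRingEnd ℂ q ≠ 0 := fun w hw h => by
    have := congrArg Complex.re h
    simp at this
    linarith [hre w hw]
  have hz1 : ‖z‖ < 1 := by simpa using hz
  -- This Cayley transform sends the right half-plane to the disk and `q` to 0, so the Schwarz lemma
  -- applies.
  have h := Complex.norm_le_norm_of_mapsTo_ball
    (f := fun w => (p w - q) / (p w + starRingEnd ℂ q)) (R := 1)
    ((hp.sub_const q).div (hp.add_const _) hden) (fun w hw => ?_) (by simp [hq]) hz1
  · simp only [norm_div] at h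
    rw [div_le_iff₀ (norm_pos_iff.2 (hden z hz))] at h
    have h2 := pow_le_pow_left₀ (norm_nonneg _) h 2
    rw [mul_pow, Complex.sq_norm (p z - q), Complex.sq_norm (p z + _), Complex.normSq_apply,
      Complex.normSq_apply] at h2
    simp at h2
    have h3 : ((p z).re - q.re) ^ 2 ≤ (‖z‖ * ((p z).re + q.re)) ^ 2 := by
      nlinarith [mul_nonneg (sub_nonneg.2 (pow_le_one₀ (n := 2) (norm_nonneg z) hz1.le))
        (sq_nonneg ((p z).im - q.im))]
    have := abs_le_of_sq_le_sq' h3 (mul_nonneg (norm_nonneg _) (by linarith [hre z hz]))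
    linarith
  · rw [mem_closedBall_zero_iff, norm_div]
    refine div_le_one_of_le₀ ?_ (norm_nonneg _)
    refine le_of_sq_le_sq ?_ (norm_nonneg _)
    rw [Complex.sq_norm, Complex.sq_norm, Complex.normSq_apply, Complex.normSq_apply]
    simp
    nlinarith [mul_nonneg (hre w hw) h0.le]

/-! ### Existence and size of the resolvent -/

/-- A holomorphic map of the disk fixing `0` and not decreasing the modulus is onto the disk. -/
theorem ball_subset_image_of_norm_le {h : ℂ → ℂ} (hd : DifferentiableOn ℂ h (ball 0 1))
    (h0 : h 0 = 0) (hle : ∀ w ∈ ball (0 : ℂ) 1, ‖w‖ ≤ ‖h w‖) :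
    ball (0 : ℂ) 1 ⊆ h '' ball 0 1 := by
  intro z hz
  obtain ⟨ρ, hzρ, hρ⟩ := exists_between (show ‖z‖ < 1 by simpa using hz)
  have hρ0 : 0 < ρ := (norm_nonneg z).trans_lt hzρ
  have hsub : closedBall (0 : ℂ) ρ ⊆ ball 0 1 := closedBall_subset_ball hρ
  have hopen : IsOpen (h '' ball 0 ρ) := by
    rcases (hd.analyticOnNhd isOpen_ball).is_constant_or_isOpen
      (convex_ball (0 : ℂ) 1).isPreconnected with ⟨c, hc⟩ | ho
    · have h1 : ((ρ : ℝ) : ℂ) ∈ ball (0 : ℂ) 1 := by simpa [abs_of_pos hρ0] using hρ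
      have h2 := hle _ h1
      rw [hc _ h1, ← hc 0 (by simp), h0] at h2
      simp [abs_of_pos hρ0] at h2
      linarith
    · exact ho _ (ball_subset_closedBall.trans hsub) isOpen_ball
  have hclosed : IsClosed (h '' closedBall 0 ρ) :=
    ((isCompact_closedBall _ _).image_of_continuousOn (hd.continuousOn.mono hsub)).isClosed
  -- Connectedness: the image is open, and closed relative to the ball because `‖w‖ ≤ ‖h w‖ < ρ`
  -- keeps preimages off the boundary circle.
  have hmain : ball (0 : ℂ) ρ ⊆ h '' ball 0 ρ := by
    refine (convex_ball (0 : ℂ) ρ).isPreconnected.subset_of_closure_inter_subset hopen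
      ⟨0, by simpa using hρ0, 0, by simpa using hρ0, h0⟩ ?_
    rintro y ⟨hy, hyρ⟩
    obtain ⟨w, hw, rfl⟩ := closure_minimal (image_mono ball_subset_closedBall) hclosed hy
    exact ⟨w, by simpa using (hle w (hsub hw)).trans_lt (by simpa using hyρ), rfl⟩
  obtain ⟨w, hw, hwz⟩ := hmain (show z ∈ ball (0 : ℂ) ρ by simpa using hzρ)
  exact ⟨w, hsub (ball_subset_closedBall hw), hwz⟩

theorem IsDiskGenerator.differentiableOn_dslope {f : ℂ → ℂ} (hf : IsDiskGenerator f) :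
    DifferentiableOn ℂ (dslope f 0) (ball 0 1) :=
  (Complex.differentiableOn_dslope (ball_mem_nhds _ one_pos)).2 hf.1

/-- The Berkson-Porta factor `f(z) / z` has non-negative real part. -/
theorem IsDiskGenerator.re_dslope_nonneg {f : ℂ → ℂ} (hf : IsDiskGenerator f) (hf0 : f 0 = 0)
    (hq : 0 < (deriv f 0).re) {z : ℂ} (hz : z ∈ ball (0 : ℂ) 1) : 0 ≤ (dslope f 0 z).re := by
  rcases eq_or_ne z 0 with rfl | hz0
  · simpa using hq.le
  · have h := hf.re_conj_mul_nonneg hf0 hz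
    have hfz : f z = z * dslope f 0 z := by
      simpa [hf0] using (sub_smul_dslope f 0 z).symm
    rw [hfz, ← mul_assoc, mul_comm (starRingEnd ℂ z), Complex.mul_conj, Complex.re_ofReal_mul] at h
    exact nonneg_of_mul_nonneg_right h (Complex.normSq_pos.2 hz0)

theorem add_mul_eq_mul_dslope {f : ℂ → ℂ} (hf0 : f 0 = 0) (r : ℝ) (w : ℂ) :
    w + (r : ℂ) * f w = w * (1 + r * dslope f 0 w) := by
  have hfz : f w = w * dslope f 0 w := by
    simpa [hf0] using (sub_smul_dslope f 0 w).symm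
  rw [hfz]
  ring

/-- The resolvent solves the resolvent equation in the disk. -/
theorem IsDiskGenerator.nonlinearResolvent_spec {f : ℂ → ℂ} (hf : IsDiskGenerator f)
    (hf0 : f 0 = 0) (hq : 0 < (deriv f 0).re) {r : ℝ} (hr : 0 ≤ r) {z : ℂ}
    (hz : z ∈ ball (0 : ℂ) 1) :
    nonlinearResolvent f r z ∈ ball (0 : ℂ) 1 ∧
      nonlinearResolvent f r z + r * f (nonlinearResolvent f r z) = z := by
  have hex : z ∈ (fun w : ℂ => w + (r : ℂ) * f w) '' ball 0 1 := by
    refine ball_subset_image_of_norm_le (h := fun w => w + (r : ℂ) * f w)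
      (differentiableOn_id.add (hf.1.const_mul _)) (by simp [hf0])
      (fun w hw => ?_) hz
    simp only [add_mul_eq_mul_dslope hf0, norm_mul]
    refine le_mul_of_one_le_right (norm_nonneg w) (le_trans ?_ (Complex.re_le_norm _))
    simpa using mul_nonneg hr (hf.re_dslope_nonneg hf0 hq hw)
  exact ⟨Function.invFunOn_mem hex, Function.invFunOn_eq hex⟩

theorem IsDiskGenerator.norm_nonlinearResolvent_le {f : ℂ → ℂ} (hf : IsDiskGenerator f)
    (hf0 : f 0 = 0) (hq : 0 < (deriv f 0).re) {r : ℝ} (hr : 2 / (deriv f 0).re < r) {z : ℂ}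
    (hz : z ∈ ball (0 : ℂ) 1) :
    ‖nonlinearResolvent f r z‖ ≤ 3 / (1 + r * (deriv f 0).re) := by
  have hr0 : 0 < r := lt_trans (by positivity) hr
  obtain ⟨hw, heq⟩ := hf.nonlinearResolvent_spec hf0 hq hr0.le hz
  set w := nonlinearResolvent f r z
  have ha : 2 < r * (deriv f 0).re := (div_lt_iff₀ hq).1 hr
  have hw1 : ‖w‖ < 1 := by simpa using hw
  have hw0 := norm_nonneg w
  have harn := re_harnack hf.differentiableOn_dslope
    (fun z hz => hf.re_dslope_nonneg hf0 hq hz) (by simpa using hq) hw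
  rw [dslope_same] at harn
  rw [add_mul_eq_mul_dslope hf0] at heq
  have hnorm : ‖w‖ * (1 + r * (dslope f 0 w).re) < 1 := by
    have h1 : 1 + r * (dslope f 0 w).re ≤ ‖1 + r * dslope f 0 w‖ := by
      simpa using Complex.re_le_norm (1 + r * dslope f 0 w)
    calc _ ≤ ‖w‖ * ‖1 + r * dslope f 0 w‖ := by gcongr
      _ = ‖z‖ := by rw [← norm_mul, heq]
      _ < 1 := by simpa using hz
  set a := r * (deriv f 0).re
  have h1 : a * (1 - ‖w‖) ≤ r * (dslope f 0 w).re * (1 + ‖w‖) := by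
    simpa [a, mul_assoc] using mul_le_mul_of_nonneg_left harn hr0.le
  have h2 : ‖w‖ * (1 + ‖w‖ + a * (1 - ‖w‖)) < 1 + ‖w‖ := by
    calc _ ≤ ‖w‖ * (1 + ‖w‖ + r * (dslope f 0 w).re * (1 + ‖w‖)) := by gcongr
      _ = ‖w‖ * (1 + r * (dslope f 0 w).re) * (1 + ‖w‖) := by ring
      _ < 1 * (1 + ‖w‖) := by gcongr
      _ = _ := one_mul _
  -- The quadratic inequality `h2` in `‖w‖` factors, with one root at 1.
  have h3 : 0 < (1 - (a - 1) * ‖w‖) * (1 - ‖w‖) := by linarith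
  have h4 := pos_of_mul_pos_left h3 (sub_nonneg.2 hw1.le)
  rw [le_div_iff₀ (by linarith)]
  nlinarith

/-! ### Boundary fixed points and the limit -/

/-- The radius to `ζ` lies in every such region near `ζ`; nontriviality lets norm bounds pass to
angular limits. -/
theorem stolzRegion_neBot {ζ : ℂ} (hζ : ‖ζ‖ = 1) {M : ℝ} (hM : 1 < M) :
    (𝓝[stolzRegion ζ M] ζ).NeBot := by
  rw [← mem_closure_iff_nhdsWithin_neBot]
  have hlim : Tendsto (fun t : ℝ => (t : ℂ) * ζ) (𝓝[<] 1) (𝓝 ζ) := by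
    have : Tendsto (fun t : ℝ => (t : ℂ) * ζ) (𝓝 1) (𝓝 (((1 : ℝ) : ℂ) * ζ)) :=
      Continuous.tendsto (by fun_prop) 1
    simpa using this.mono_left nhdsWithin_le_nhds
  refine mem_closure_of_tendsto hlim ?_
  filter_upwards [Ioo_mem_nhdsLT (zero_lt_one (α := ℝ))] with t ht
  have h1 : ‖(t : ℂ) * ζ‖ = t := by simp [hζ, abs_of_pos ht.1]
  have h2 : ‖ζ - (t : ℂ) * ζ‖ = 1 - t := by
    rw [show ζ - (t : ℂ) * ζ = ((1 - t : ℝ) : ℂ) * ζ by push_cast; ring, norm_mul, hζ, mul_one,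
      Complex.norm_real, Real.norm_of_nonneg (by linarith [ht.2])]
  refine ⟨by rw [h1]; exact ht.2, ?_⟩
  rw [h1, h2]
  nlinarith [ht.2]

theorem not_isBoundaryFixedPoint_of_norm_le {G : ℂ → ℂ} {c : ℝ} (hc : c < 1)
    (hG : ∀ z ∈ ball (0 : ℂ) 1, ‖G z‖ ≤ c) (ζ : ℂ) : ¬ IsBoundaryFixedPoint G ζ := by
  rintro ⟨hζ, h⟩
  have := stolzRegion_neBot hζ one_lt_two
  have hle : ‖ζ‖ ≤ c := by
    refine le_of_tendsto (h 2 one_lt_two).norm ?_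
    filter_upwards [self_mem_nhdsWithin] with z hz
    exact hG z (by simpa using hz.1)
  linarith

theorem mainTheorem5 (f : ℂ → ℂ) (hf : IsDiskGenerator f) (hf0 : f 0 = 0)
    (q : ℂ) (hfq : deriv f 0 = q) (hq : 0 < q.re) :
    (∀ r : ℝ, 2 / q.re < r →
      (∀ z ∈ Metric.ball (0 : ℂ) 1, ‖nonlinearResolvent f r z‖ ≤ 3 / (1 + r * q.re)) ∧
      (∀ ζ : ℂ, ¬ IsBoundaryFixedPoint (nonlinearResolvent f r) ζ)) ∧
    TendstoUniformlyOn (fun r : ℝ => nonlinearResolvent f r) (fun _ : ℂ => (0 : ℂ)) atTop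
      (Metric.ball (0 : ℂ) 1) := by
  subst hfq
  refine ⟨fun r hr => ⟨fun z hz => hf.norm_nonlinearResolvent_le hf0 hq hr hz, ?_⟩, ?_⟩
  · refine not_isBoundaryFixedPoint_of_norm_le ?_
      fun z hz => hf.norm_nonlinearResolvent_le hf0 hq hr hz
    have ha : 2 < r * (deriv f 0).re := (div_lt_iff₀ hq).1 hr
    rw [div_lt_one (by linarith)]
    linarith
  · rw [Metric.tendstoUniformlyOn_iff]
    intro ε hε
    have hlim : Tendsto (fun r : ℝ => 3 / (1 + r * (deriv f 0).re)) atTop (𝓝 0) :=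
      tendsto_const_nhds.div_atTop
        (tendsto_atTop_add_const_left _ _ (tendsto_id.atTop_mul_const hq))
    filter_upwards [hlim.eventually_lt_const hε, eventually_gt_atTop (2 / (deriv f 0).re)]
      with r hr1 hr2 z hz
    rw [dist_zero_left]
    exact (hf.norm_nonlinearResolvent_le hf0 hq hr2 hz).trans_lt hr1
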